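/- **Conventions.** Identify $\mathbb N$ with $\{0,1\}^*$ (so $0$ is the empty word $\epsilon$); logarithms are binary, and $-\log 0=\infty$. A *prefix machine* is a partial recursive function $V(p,y)$ of a program $p\in\{0,1\}^*$ and a condition $y\in\mathbb N$ such that for every $y$ the set $\{p: V(p,y)\text{ halts}\}$ is prefix-free. Fix a universal prefix machine $U$: for every prefix machine $V$ there is a constant $c$ such that whenever $V(p,y)=x$ there is a program $q$ with $l(q)\le l(p)+c$ and $U(q,y)=x$. The prefix complexity is $K(x|y)=\min\{l(p):U(p,y)=x\}$, and $K(x)=K(x|\epsilon)$. A probability distribution is a function $P:\mathbb N\to[0,1]$ with $\sum_xP(x)\le1$. It is *recursive* if some program, for every argument $x$ and precision $b$, outputs a fraction within $2^{-b}$ of $P(x)$; such a program is said to compute $P$, and $K(P)$ is the minimum of $K(e)$ over all (indices $e$ of) programs computing $P$. $\Pr(\cdot|\cdot)$ is a recursive conditional distribution if each $\Pr(\cdot|y)$ is a probability distribution and $\Pr(x|y)$ is recursive as a function of $(x,y)$. Fix a universal distribution $\mathbf m(\cdot|\cdot)$: an enumerable (computably approximable from below) conditional probability distribution such that for every enumerable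 conditional probability distribution $Q$ there is a constant $c>0$ with $Q(x|y)\le c\,\mathbf m(x|y)$ for all $x,y$; put $\mathbf m(x)=\mathbf m(x|\epsilon)$. For real $d$, $D$ is *$\Pr(\cdot|H)$-random with deficiency at most $d$* if $\log\bigl(\mathbf m(D|H)/\Pr(D|H)\bigr)\le d$, and $H$ is *$P$-random with deficiency at most $d$* if $\log\bigl(\mathbf m(H)/P(H)\bigr)\le d$ (a test value is $\infty$ when the denominator is $0$); $d=0$ is Martin-Löf randomness with threshold $0$. **Theorem (Fundamental Inequality).** (i) There is a constant $c$, depending only on $U$ and $\mathbf m$, such that for all recursive $\Pr(\cdot|\cdot)$ and $P$, all $D,H\in\mathbb N$ and all real $d_1,d_2$: if $D$ is $\Pr(\cdot|H)$-random with deficiency at most $d_1$ and $H$ is $P$-random with deficiency at most $d_2$, then $$K(D|H)+K(H)-\alpha(P,H)-c\;\le\;-\log\Pr(D|H)-\log P(H)\;\le\;K(D|H)+K(H)+d_1+d_2+c,$$ where $\alpha(P,H)=K(\Pr(\cdot|H))+K(P)$. (ii) Conversely, for all recursive $\Pr(\cdot|\cdot)$ and $P$ and every constant $c$ there is a constant $d$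 such that for all $D,H\in\mathbb N$: if $$\bigl|\,-\log\Pr(D|H)-\log P(H)-K(D|H)-K(H)\,\bigr|\le c,$$ then $D$ is $\Pr(\cdot|H)$-random with deficiency at most $d$ and $H$ is $P$-random with deficiency at most $d$. -/

import Mathlib

open Filter Topology

namespace AlgMDL

/-! Natural numbers and finite binary strings are identified, so data samples, hypotheses and
conditions are natural numbers (the empty string is `0`). Programs are lists of bits. All
logarithms are binary. -/

/-- A prefix machine: a partial recursive function of a program `p` and a condition `y` whose
halting programs form a prefix-free set, for every condition `y`. -/
structure IsPrefixMachine (V : List Bool → ℕ →. ℕ) : Prop where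
  partrec : Partrec₂ V
  prefixFree : ∀ (y : ℕ) (p q : List Bool), (V p y).Dom → (V q y).Dom → p <+: q → p = q

/-- A universal (additively optimal) prefix machine `U`: a prefix machine such that for each prefix
machine `V` there is a constant `c` so that whatever `V` computes from a program `p` and a
condition `y`, `U` computes from `y` and some program that is at most `c` bits longer than `p`. -/
structure IsUniversalPrefixMachine (U : List Bool → ℕ →. ℕ) : Prop where
  isPrefixMachine : IsPrefixMachine U
  universal : ∀ V : List Bool → ℕ →. ℕ, IsPrefixMachine V →
    ∃ c : ℕ, ∀ (p : List Bool) (y x : ℕ), x ∈ V p y →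
      ∃ q : List Bool, q.length ≤ p.length + c ∧ x ∈ U q y

/-- The conditional prefix complexity `K(x | y)` with respect to the machine `U`. -/
noncomputable def condK (U : List Bool → ℕ →. ℕ) (x y : ℕ) : ℕ :=
  sInf {n | ∃ p : List Bool, p.length = n ∧ x ∈ U p y}

/-- The prefix complexity `K(x) = K(x | ε)`. -/
noncomputable def prefixK (U : List Bool → ℕ →. ℕ) (x : ℕ) : ℕ := condK U x 0

/-- A probability distribution on `ℕ`, in the convention where the total mass is at most `1`. -/
structure IsDistribution (P : ℕ → ℝ) : Prop where
  nonneg : ∀ x, 0 ≤ P x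
  summable : Summable P
  tsum_le_one : ∑' x, P x ≤ 1

/-- The program `e` computes the real function `f`: on every argument `x` and precision `b` it halts
with (the code of) a fraction that is within `2 ^ (-b)` of `f x`. -/
def ComputesReal (e : Nat.Partrec.Code) (f : ℕ → ℝ) : Prop :=
  ∀ x b : ℕ, ∃ p q : ℕ, Nat.pair p q ∈ e.eval (Nat.pair x b) ∧ 0 < q ∧
    |f x - (p : ℝ) / (q : ℝ)| ≤ (2 : ℝ)⁻¹ ^ b

/-- `P` is a recursive probability distribution. -/
def IsRecursiveDist (P : ℕ → ℝ) : Prop :=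
  IsDistribution P ∧ ∃ e : Nat.Partrec.Code, ComputesReal e P

/-- `Pr x y` stands for `Pr(x | y)`: each `Pr(· | y)` is a probability distribution, and
`Pr(· | ·)` is recursive as a function of both arguments. -/
def IsRecursiveCondDist (Pr : ℕ → ℕ → ℝ) : Prop :=
  (∀ y, IsDistribution fun x => Pr x y) ∧
    ∃ e : Nat.Partrec.Code, ComputesReal e fun z => Pr z.unpair.1 z.unpair.2

/-- The prefix complexity `K(P)` of a recursive distribution: the length of a shortest program from
which `U` produces (the index of) a program computing `P`. -/
noncomputable def distK (U : List Bool → ℕ →. ℕ) (P : ℕ → ℝ) : ℕ :=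
  sInf {n | ∃ e : Nat.Partrec.Code, ComputesReal e P ∧ n = prefixK U (Encodable.encode e)}

/-- `f` is enumerable: the limit of a computable nondecreasing sequence of fractions. -/
def IsEnumerable (f : ℕ → ℕ → ℝ) : Prop :=
  ∃ φ : ℕ × ℕ × ℕ → ℕ × ℕ, Computable φ ∧ (∀ z, 0 < (φ z).2) ∧
    ∀ x y : ℕ,
      Monotone (fun t : ℕ => ((φ (x, y, t)).1 : ℝ) / ((φ (x, y, t)).2 : ℝ)) ∧
      Tendsto (fun t : ℕ => ((φ (x, y, t)).1 : ℝ) / ((φ (x, y, t)).2 : ℝ)) atTop (𝓝 (f x y))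

/-- `m x y` stands for `m(x | y)`, a universal distribution: an enumerable conditional probability
distribution that multiplicatively dominates every enumerable conditional probability distribution.
The unconditional universal distribution is `m(x) = m(x | ε)`. -/
structure IsUniversalDist (m : ℕ → ℕ → ℝ) : Prop where
  isDistribution : ∀ y, IsDistribution fun x => m x y
  enumerable : IsEnumerable m
  universal : ∀ Q : ℕ → ℕ → ℝ, (∀ y, IsDistribution fun x => Q x y) → IsEnumerable Q →
    ∃ c : ℝ, 0 < c ∧ ∀ x y, Q x y ≤ c * m x y

/-- `- log p` for a probability `p`, with `- log 0 = ∞`. -/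
noncomputable def negLog (p : ℝ) : EReal :=
  if p = 0 then ⊤ else ((-Real.logb 2 p : ℝ) : EReal)

/-- The universal randomness test `log (μ(x) / P(x))`, where `μ` is the universal distribution;
it is infinite if `P(x) = 0`. -/
noncomputable def universalTest (μ P : ℕ → ℝ) (x : ℕ) : EReal :=
  if P x = 0 then ⊤ else ((Real.logb 2 (μ x / P x) : ℝ) : EReal)

/-- `x` is Martin-Löf random for `P` with randomness deficiency at most `d`. -/
def IsRandom (μ P : ℕ → ℝ) (d : ℝ) (x : ℕ) : Prop :=
  universalTest μ P x ≤ (d : EReal)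

/-- `α(P, H) = K(Pr(· | H)) + K(P)`. -/
noncomputable def alpha (U : List Bool → ℕ →. ℕ) (Pr : ℕ → ℕ → ℝ) (P : ℕ → ℝ) (H : ℕ) : ℕ :=
  distK U (fun x => Pr x H) + distK U P

end AlgMDL

open AlgMDL

namespace AlgMDL

/-! ### Stagewise approximation of partial recursive functions -/

/-! Everything reduces to comparing `-log` of a probability with `K`, once for `D` given `H` and
once for `H`. Three comparisons suffice. Shannon–Fano coding bounds `K(x|y)` by `-log P(x) + K(P)`,
with a constant uniform in `P` (`condK_le_neg_logb_add_distK`). The coding theorem bounds `K` by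
`-log m` (`condK_le_neg_logb_universal`). Domination of `2^(-K)` by `m` gives the reverse bound
(`neg_logb_le_condK`). In (i), Shannon–Fano gives the lower bound. Randomness with domination gives
the upper one. In (ii), the bound on the sum of the two code lengths, minus the Shannon–Fano lower
bound for one of them, bounds the other from above; the coding theorem turns that into a deficiency
bound. Both bounds on `K` come from one online Kraft–Chaitin construction (`condK_le_of_request`):
any distribution approximable from below yields a stream of codeword requests of total weight at
most 1. Domination comes from Kraft's inequality and the approximation of `K` from above. -/

theorem exists_stages {α σ : Type*} [Primcodable α] [Primcodable σ] {f : α →. σ}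
    (hf : Partrec f) :
    ∃ F : α → ℕ → Option σ, Primrec₂ F ∧ (∀ a, F a 0 = none) ∧
      (∀ a s t b, s ≤ t → b ∈ F a s → b ∈ F a t) ∧ ∀ a b, b ∈ f a ↔ ∃ s, b ∈ F a s := by
  obtain ⟨c, hc⟩ := Nat.Partrec.Code.exists_code.1 hf
  have hce : ∀ a, c.eval (Encodable.encode a) = (f a).map Encodable.encode := by
    intro a
    rw [hc]
    simp
  refine ⟨fun a s => (Nat.Partrec.Code.evaln s c (Encodable.encode a)).bind Encodable.decode,
    ?_, ?_, ?_, ?_⟩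
  · refine Primrec.option_bind
      (Nat.Partrec.Code.primrec_evaln.comp
        (((Primrec.snd).pair (Primrec.const c)).pair (Primrec.encode.comp Primrec.fst))) ?_
    exact Primrec.decode.comp Primrec.snd
  · intro a
    simp [Nat.Partrec.Code.evaln]
  · intro a s t b hst h
    simp only [Option.mem_def, Option.bind_eq_some_iff] at h ⊢
    obtain ⟨n, hn, hb⟩ := h
    exact ⟨n, Nat.Partrec.Code.evaln_mono hst hn, hb⟩
  · intro a b
    constructor
    · intro h
      have : Encodable.encode b ∈ c.eval (Encodable.encode a) := by
        rw [hce]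
        exact Part.mem_map _ h
      obtain ⟨s, hs⟩ := Nat.Partrec.Code.evaln_complete.1 this
      refine ⟨s, ?_⟩
      simp only [Option.mem_def] at hs ⊢
      simp [hs]
    · rintro ⟨s, hs⟩
      simp only [Option.mem_def, Option.bind_eq_some_iff] at hs
      obtain ⟨n, hn, hb⟩ := hs
      have := Nat.Partrec.Code.evaln_sound hn
      rw [hce] at this
      obtain ⟨b', hb', rfl⟩ := (Part.mem_map_iff _).1 this
      simp only [Encodable.encodek, Option.some.injEq] at hb
      exact hb ▸ hb'

/-! ### Kraft's inequality for prefix-free sets -/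

/-- The first words of two parsings are prefixes of the same string, hence comparable, hence equal;
cancel them and induct. -/
theorem uniquelyDecodable_of_prefixFree {α : Type*} {S : Set (List α)}
    (h : ∀ p ∈ S, ∀ q ∈ S, p <+: q → p = q) (hnil : [] ∉ S) :
    InformationTheory.UniquelyDecodable S := by
  intro L₁
  induction L₁ with
  | nil =>
    intro L₂ _ h₂ he
    cases L₂ with
    | nil => rfl
    | cons w L =>
      simp only [List.flatten_nil, List.flatten_cons] at he
      have : w = [] := (List.append_eq_nil_iff.1 he.symm).1
      exact absurd (this ▸ h₂ w (by simp)) hnil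
  | cons v L ih =>
    intro L₂ h₁ h₂ he
    cases L₂ with
    | nil =>
      simp only [List.flatten_nil, List.flatten_cons] at he
      have : v = [] := (List.append_eq_nil_iff.1 he).1
      exact absurd (this ▸ h₁ v (by simp)) hnil
    | cons w M =>
      simp only [List.flatten_cons] at he
      have hvw : v = w := by
        rcases List.prefix_or_prefix_of_prefix (List.prefix_append v L.flatten)
          (he ▸ List.prefix_append w M.flatten) with h' | h'
        · exact h v (h₁ v (by simp)) w (h₂ w (by simp)) h'
        · exact (h w (h₂ w (by simp)) v (h₁ v (by simp)) h').symm
      subst hvw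
      rw [ih M (fun w hw => h₁ w (by simp [hw])) (fun w hw => h₂ w (by simp [hw]))
        (List.append_cancel_left he)]

theorem kraft_inequality (S : Finset (List Bool)) (h : ∀ p ∈ S, ∀ q ∈ S, p <+: q → p = q) :
    ∑ w ∈ S, (2 : ℝ)⁻¹ ^ w.length ≤ 1 := by
  by_cases hnil : [] ∈ S
  · have : S = {[]} := by
      ext w
      rw [Finset.mem_singleton]
      exact ⟨fun hw => (h _ hnil w hw w.nil_prefix).symm, fun hw => hw ▸ hnil⟩
    simp [this]
  · simpa using InformationTheory.kraft_mcmillan_inequality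
      (uniquelyDecodable_of_prefixFree (S := (S : Set (List Bool))) h hnil)

/-! ### Binary values of words -/

/-- The natural number with binary expansion `q`, most significant bit first. -/
def bitsVal (q : List Bool) : ℕ := q.foldl (fun v b => 2 * v + b.toNat) 0

theorem primrec_bitsVal : Primrec bitsVal := by
  have h : Primrec fun b : Bool => b.toNat := Primrec.dom_bool _
  refine Primrec.list_foldl (h := fun (_ : List Bool) (z : ℕ × Bool) => 2 * z.1 + z.2.toNat)
    Primrec.id (Primrec.const 0) ?_
  exact Primrec.nat_add.comp
    (Primrec.nat_mul.comp (Primrec.const 2) (Primrec.fst.comp Primrec.snd))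
    (h.comp (Primrec.snd.comp Primrec.snd))

theorem bitsVal_concat (q : List Bool) (b : Bool) :
    bitsVal (q ++ [b]) = 2 * bitsVal q + b.toNat := by
  simp [bitsVal]

/-- Extending a word shrinks its dyadic interval `[bitsVal p, bitsVal p + 1] / 2^|p|` to a
subinterval. -/
theorem bitsVal_append (p q : List Bool) :
    bitsVal p * 2 ^ q.length ≤ bitsVal (p ++ q) ∧
      bitsVal (p ++ q) + 1 ≤ (bitsVal p + 1) * 2 ^ q.length := by
  induction q using List.reverseRecOn with
  | nil => simp
  | append_singleton q b ih =>
    rw [← List.append_assoc, bitsVal_concat, List.length_append, List.length_singleton, pow_succ]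
    have : b.toNat ≤ 1 := Bool.toNat_le b
    constructor <;> nlinarith [ih.1, ih.2]

theorem exists_bitsVal_eq (n j : ℕ) (hj : j < 2 ^ n) :
    ∃ q : List Bool, q.length = n ∧ bitsVal q = j := by
  induction n generalizing j with
  | zero => exact ⟨[], rfl, by simp at hj; simp [bitsVal, hj]⟩
  | succ n ih =>
    obtain ⟨q, hq, hv⟩ := ih (j / 2) (by rw [pow_succ] at hj; omega)
    refine ⟨q ++ [decide (j % 2 = 1)], by simp [hq], ?_⟩
    rw [bitsVal_concat, hv]
    by_cases h : j % 2 = 1 <;> simp [h] <;> omega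

/-! ### Online Kraft–Chaitin coding

A request `(x, ℓ)` asks for a codeword of length `ℓ + 1` for `x`. Requests arrive as a stream, the
`t`-th one is served by a dyadic interval inside `[S t, S (t + 1)]`, where `S t` is the total weight
of the requests before `t`. -/

/-- The weight `2 ^ (-ℓ)` of a request. -/
noncomputable def reqWeight (o : Option (ℕ × ℕ)) : ℝ := o.elim 0 fun r => (2 : ℝ)⁻¹ ^ r.2

theorem reqWeight_nonneg (o : Option (ℕ × ℕ)) : 0 ≤ reqWeight o := by
  cases o <;> simp [reqWeight]

/-- The total weight of the requests before time `t`, as numerator and binary exponent of the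
denominator. -/
def cumWeight (req : ℕ → Option (ℕ × ℕ)) (t : ℕ) : ℕ × ℕ :=
  Nat.rec (0, 0)
    (fun t s => ((req t).map fun r => (s.1 * 2 ^ r.2 + 2 ^ s.2, s.2 + r.2)).getD s) t

theorem cumWeight_eq (req : ℕ → Option (ℕ × ℕ)) (t : ℕ) :
    ((cumWeight req t).1 : ℝ) =
      (∑ s ∈ Finset.range t, reqWeight (req s)) * 2 ^ (cumWeight req t).2 := by
  induction t with
  | zero => simp [cumWeight]
  | succ t ih =>
    rw [Finset.sum_range_succ]
    have hstep : cumWeight req (t + 1) = ((req t).map fun r =>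
        ((cumWeight req t).1 * 2 ^ r.2 + 2 ^ (cumWeight req t).2,
          (cumWeight req t).2 + r.2)).getD (cumWeight req t) := rfl
    rw [hstep]
    cases h : req t with
    | none => simpa [reqWeight] using ih
    | some r =>
      have hw : reqWeight (some r) = (2 ^ r.2)⁻¹ := by simp [reqWeight]
      simp only [Option.map_some, Option.getD_some, hw]
      push_cast
      rw [ih, pow_add]
      field_simp

/-- The object encoded by `q` if `q` is a codeword for the request at time `t`. -/
def decodeWord (req : ℕ → Option (ℕ × ℕ)) (q : List Bool) (t : ℕ) : Option ℕ :=
  (req t).bind fun r =>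
    if (q.length = r.2 + 1 ∧
        (cumWeight req t).1 * 2 ^ (r.2 + 1) ≤ 2 ^ (cumWeight req t).2 * bitsVal q) ∧
      2 ^ (cumWeight req t).2 * (bitsVal q + 1) ≤
        (cumWeight req t).1 * 2 ^ (r.2 + 1) + 2 * 2 ^ (cumWeight req t).2
    then some r.1 else none

/-- Clearing the denominator of `cumWeight` keeps the test in `decodeWord` integral; over the reals
it says that the dyadic interval of `q` lies in `[S t, S t + 2^(-ℓ)]`. -/
theorem mem_decodeWord {req : ℕ → Option (ℕ × ℕ)} {q : List Bool} {t x : ℕ} :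
    x ∈ decodeWord req q t ↔ ∃ ℓ, req t = some (x, ℓ) ∧ q.length = ℓ + 1 ∧
      (∑ s ∈ Finset.range t, reqWeight (req s)) * 2 ^ (ℓ + 1) ≤ bitsVal q ∧
      (bitsVal q : ℝ) + 1 ≤ (∑ s ∈ Finset.range t, reqWeight (req s)) * 2 ^ (ℓ + 1) + 2 := by
  have hk : (0 : ℝ) < 2 ^ (cumWeight req t).2 := by positivity
  have h1 : ∀ ℓ, (cumWeight req t).1 * 2 ^ (ℓ + 1) ≤ 2 ^ (cumWeight req t).2 * bitsVal q ↔
      (∑ s ∈ Finset.range t, reqWeight (req s)) * 2 ^ (ℓ + 1) ≤ bitsVal q := by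
    intro ℓ
    rw [← @Nat.cast_le ℝ]
    push_cast
    rw [cumWeight_eq, mul_comm _ ((2 : ℝ) ^ (cumWeight req t).2), mul_assoc,
      mul_le_mul_iff_right₀ hk]
  have h2 : ∀ ℓ, 2 ^ (cumWeight req t).2 * (bitsVal q + 1) ≤
        (cumWeight req t).1 * 2 ^ (ℓ + 1) + 2 * 2 ^ (cumWeight req t).2 ↔
      (bitsVal q : ℝ) + 1 ≤
        (∑ s ∈ Finset.range t, reqWeight (req s)) * 2 ^ (ℓ + 1) + 2 := by
    intro ℓ
    rw [← @Nat.cast_le ℝ]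
    push_cast
    rw [cumWeight_eq, mul_comm _ ((2 : ℝ) ^ (cumWeight req t).2), mul_assoc,
      mul_comm (2 : ℝ) (2 ^ _), ← mul_add, mul_le_mul_iff_right₀ hk]
  simp only [decodeWord, Option.mem_def, Option.bind_eq_some_iff, h1, h2,
    Option.ite_none_right_eq_some, Option.some.injEq]
  constructor
  · rintro ⟨⟨x', ℓ⟩, hr, ⟨⟨ha, hb⟩, hc⟩, rfl⟩
    exact ⟨ℓ, hr, ha, hb, hc⟩
  · rintro ⟨ℓ, hr, ha, hb, hc⟩
    exact ⟨(x, ℓ), hr, ⟨⟨ha, hb⟩, hc⟩, rfl⟩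

theorem decodeWord_interval {req : ℕ → Option (ℕ × ℕ)} {q : List Bool} {t x : ℕ}
    (h : x ∈ decodeWord req q t) :
    (∑ s ∈ Finset.range t, reqWeight (req s)) * 2 ^ q.length ≤ bitsVal q ∧
      (bitsVal q : ℝ) + 1 ≤ (∑ s ∈ Finset.range (t + 1), reqWeight (req s)) * 2 ^ q.length := by
  obtain ⟨ℓ, hr, ha, hb, hc⟩ := mem_decodeWord.1 h
  rw [ha]
  refine ⟨hb, hc.trans_eq ?_⟩
  rw [Finset.sum_range_succ, hr, add_mul]
  simp [reqWeight, pow_succ]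

/-- The interval of `q'` lies inside that of `q`, while slots of different times do not overlap. No
bound on the total weight is needed, so decoding is prefix-free for every request stream. -/
theorem decodeWord_time_le {req : ℕ → Option (ℕ × ℕ)} {q q' : List Bool} {t t' x x' : ℕ}
    (h : x ∈ decodeWord req q t) (h' : x' ∈ decodeWord req q' t') {r : List Bool}
    (hr : q ++ r = q') : t' ≤ t ∧ t ≤ t' := by
  have hmono : Monotone fun t => ∑ s ∈ Finset.range t, reqWeight (req s) :=
    Finset.sum_mono_set_of_nonneg (fun _ => reqWeight_nonneg _) |>.comp Finset.range_mono
  obtain ⟨a1, a2⟩ := decodeWord_interval h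
  obtain ⟨b1, b2⟩ := decodeWord_interval h'
  have c1 : (bitsVal q : ℝ) * 2 ^ r.length ≤ bitsVal q' := by
    exact_mod_cast hr ▸ (bitsVal_append q r).1
  have c2 : (bitsVal q' : ℝ) + 1 ≤ (bitsVal q + 1) * 2 ^ r.length := by
    exact_mod_cast hr ▸ (bitsVal_append q r).2
  have hlen : (2 : ℝ) ^ q'.length = 2 ^ q.length * 2 ^ r.length := by
    rw [← hr, List.length_append, pow_add]
  have hpos : (0 : ℝ) < 2 ^ q'.length := by positivity
  have hrpos : (0 : ℝ) < 2 ^ r.length := by positivity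
  have d1 := mul_le_mul_of_nonneg_right a1 hrpos.le
  have d2 := mul_le_mul_of_nonneg_right a2 hrpos.le
  rw [mul_assoc, ← hlen] at d1 d2
  constructor
  · by_contra! hlt
    have := mul_le_mul_of_nonneg_right (hmono (Nat.succ_le_of_lt hlt)) hpos.le
    simp only [Nat.succ_eq_add_one] at this
    linarith
  · by_contra! hlt
    have := mul_le_mul_of_nonneg_right (hmono (Nat.succ_le_of_lt hlt)) hpos.le
    simp only [Nat.succ_eq_add_one] at this
    linarith

theorem decodeWord_prefixFree {req : ℕ → Option (ℕ × ℕ)} {q q' : List Bool} {t t' x x' : ℕ}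
    (h : x ∈ decodeWord req q t) (h' : x' ∈ decodeWord req q' t') (hq : q <+: q') :
    q = q' ∧ x = x' := by
  obtain ⟨r, hr⟩ := hq
  obtain ⟨h1, h2⟩ := decodeWord_time_le h h' hr
  obtain rfl := le_antisymm h1 h2
  obtain ⟨ℓ, hr1, ha, -⟩ := mem_decodeWord.1 h
  obtain ⟨ℓ', hr2, ha', -⟩ := mem_decodeWord.1 h'
  rw [hr1] at hr2
  simp only [Option.some.injEq, Prod.mk.injEq] at hr2
  exact ⟨List.IsPrefix.eq_of_length ⟨r, hr⟩ (by omega), hr2.1⟩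

/-- A slot of length `2^(-ℓ)` need not be aligned to the dyadic grid, but it contains a grid cell of
half that length: the first one starting at or after `S`. This costs the extra bit. -/
theorem exists_decodeWord {req : ℕ → Option (ℕ × ℕ)} {t x ℓ : ℕ} (h : req t = some (x, ℓ))
    (hle : ∑ s ∈ Finset.range (t + 1), reqWeight (req s) ≤ 1) :
    ∃ q : List Bool, q.length = ℓ + 1 ∧ x ∈ decodeWord req q t := by
  set S := ∑ s ∈ Finset.range t, reqWeight (req s) with hS
  have hS0 : 0 ≤ S := Finset.sum_nonneg fun _ _ => reqWeight_nonneg _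
  have hnn : 0 ≤ S * 2 ^ (ℓ + 1) := by positivity
  have hj2 := Nat.ceil_lt_add_one hnn
  have hj : ⌈S * 2 ^ (ℓ + 1)⌉₊ < 2 ^ (ℓ + 1) := by
    have h1 := mul_le_mul_of_nonneg_right hle (by positivity : (0 : ℝ) ≤ 2 ^ (ℓ + 1))
    rw [Finset.sum_range_succ, ← hS, h, add_mul, one_mul] at h1
    have h2 : reqWeight (some (x, ℓ)) * 2 ^ (ℓ + 1) = 2 := by simp [reqWeight, pow_succ]
    have h3 : (⌈S * 2 ^ (ℓ + 1)⌉₊ : ℝ) < 2 ^ (ℓ + 1) := by linarith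
    exact_mod_cast h3
  obtain ⟨q, hq, hv⟩ := exists_bitsVal_eq _ _ hj
  refine ⟨q, hq, mem_decodeWord.2 ⟨ℓ, h, hq, ?_, ?_⟩⟩
  · rw [hv]
    exact Nat.le_ceil _
  · rw [hv]
    linarith

theorem primrec_two_pow : Primrec fun n : ℕ => 2 ^ n :=
  (Primrec₂.unpaired'.1 Nat.Primrec.pow).comp (Primrec.const 2) Primrec.id

theorem primrec_cumWeight {α : Type*} [Primcodable α] {req : α → ℕ → Option (ℕ × ℕ)}
    (h : Primrec₂ req) : Primrec₂ fun a t => cumWeight (req a) t := by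
  have : Primrec₂ fun (a : α × ℕ) (s : ℕ × (ℕ × ℕ)) =>
      ((req a.1 s.1).map fun r => (s.2.1 * 2 ^ r.2 + 2 ^ s.2.2, s.2.2 + r.2)).getD s.2 := by
    refine Primrec.option_getD.comp (Primrec.option_map (h.comp (Primrec.fst.comp Primrec.fst)
      (Primrec.fst.comp Primrec.snd)) ?_) (Primrec.snd.comp Primrec.snd)
    have s2 : Primrec fun z : ((α × ℕ) × (ℕ × (ℕ × ℕ))) × (ℕ × ℕ) => z.1.2.2 :=
      Primrec.snd.comp (Primrec.snd.comp Primrec.fst)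
    have r2 : Primrec fun z : ((α × ℕ) × (ℕ × (ℕ × ℕ))) × (ℕ × ℕ) => z.2.2 :=
      Primrec.snd.comp Primrec.snd
    exact (Primrec.nat_add.comp (Primrec.nat_mul.comp (Primrec.fst.comp s2)
      (primrec_two_pow.comp r2)) (primrec_two_pow.comp (Primrec.snd.comp s2))).pair
      (Primrec.nat_add.comp (Primrec.snd.comp s2) r2)
  exact Primrec.nat_rec' Primrec.snd (Primrec.const (0, 0)) this

theorem primrec_decodeWord {α : Type*} [Primcodable α] {req : α → ℕ → Option (ℕ × ℕ)}
    (h : Primrec₂ req) :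
    Primrec fun z : α × List Bool × ℕ => decodeWord (req z.1) z.2.1 z.2.2 := by
  refine Primrec.option_bind (h.comp Primrec.fst (Primrec.snd.comp Primrec.snd)) ?_
  have c : Primrec fun z : (α × List Bool × ℕ) × (ℕ × ℕ) => cumWeight (req z.1.1) z.1.2.2 :=
    (primrec_cumWeight h).comp (Primrec.fst.comp Primrec.fst)
      (Primrec.snd.comp (Primrec.snd.comp Primrec.fst))
  have r : Primrec fun z : (α × List Bool × ℕ) × (ℕ × ℕ) => z.2.2 + 1 :=
    Primrec.succ.comp (Primrec.snd.comp Primrec.snd)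
  have q : Primrec fun z : (α × List Bool × ℕ) × (ℕ × ℕ) => z.1.2.1 :=
    Primrec.fst.comp (Primrec.snd.comp Primrec.fst)
  have a := Primrec.nat_mul.comp (Primrec.fst.comp c) (primrec_two_pow.comp r)
  have k := primrec_two_pow.comp (Primrec.snd.comp c)
  have b := primrec_bitsVal.comp q
  exact Primrec.ite
    (((Primrec.eq.comp (Primrec.list_length.comp q) r).and
      (Primrec.nat_le.comp a (Primrec.nat_mul.comp k b))).and
      (Primrec.nat_le.comp (Primrec.nat_mul.comp k (Primrec.succ.comp b))
        (Primrec.nat_add.comp a (Primrec.nat_mul.comp (Primrec.const 2) k))))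
    (Primrec.option_some.comp (Primrec.fst.comp Primrec.snd)) (Primrec.const none)

/-! ### Complexity bounds from request streams -/

theorem condK_le {U : List Bool → ℕ →. ℕ} {p : List Bool} {x y : ℕ} (h : x ∈ U p y) :
    condK U x y ≤ p.length :=
  Nat.sInf_le ⟨p, rfl, h⟩

/-- Makes the infimum defining `condK` attained, and supplies the computable upper bound from which
`K` is later approximated. -/
theorem IsUniversalPrefixMachine.exists_program {U : List Bool → ℕ →. ℕ}
    (hU : IsUniversalPrefixMachine U) :
    ∃ c : ℕ, ∀ x y, ∃ q : List Bool, q.length ≤ x + c ∧ x ∈ U q y := by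
  set req : Unit → ℕ → Option (ℕ × ℕ) := fun _ t => some (t, t + 1) with hreq
  have hp : Primrec₂ req :=
    Primrec.option_some.comp (Primrec.snd.pair (Primrec.succ.comp Primrec.snd))
  have hsum : ∀ N, ∑ s ∈ Finset.range N, reqWeight (req () s) = 1 - (2 : ℝ)⁻¹ ^ N := by
    intro N
    induction N with
    | zero => simp
    | succ N ih =>
      rw [Finset.sum_range_succ, ih]
      simp only [hreq, reqWeight, Option.elim_some, pow_succ]
      ring
  obtain ⟨c, hc⟩ := hU.universal (fun p _ => Nat.rfindOpt (decodeWord (req ()) p))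
    { partrec := Partrec.rfindOpt (Primrec.to_comp ((primrec_decodeWord hp).comp
        ((Primrec.const ()).pair ((Primrec.fst.comp Primrec.fst).pair Primrec.snd))))
      prefixFree := by
        intro y p q h1 h2 hpq
        obtain ⟨t, x, h1⟩ := Nat.rfindOpt_dom.1 h1
        obtain ⟨t', x', h2⟩ := Nat.rfindOpt_dom.1 h2
        exact (decodeWord_prefixFree h1 h2 hpq).1 }
  refine ⟨c + 2, fun x y => ?_⟩
  obtain ⟨q, hq, hx⟩ := exists_decodeWord (req := req ()) (t := x) rfl (by
    rw [hsum]
    linarith [pow_pos (by norm_num : (0 : ℝ) < 2⁻¹) (x + 1)])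
  have : x ∈ Nat.rfindOpt (decodeWord (req ()) q) := by
    have hd : (Nat.rfindOpt (decodeWord (req ()) q)).Dom := Nat.rfindOpt_dom.2 ⟨_, _, hx⟩
    obtain ⟨t, ht⟩ := Nat.rfindOpt_spec (Part.get_mem hd)
    rw [(decodeWord_prefixFree hx ht List.prefix_rfl).2]
    exact Part.get_mem hd
  obtain ⟨q', hq', hx'⟩ := hc q y x this
  exact ⟨q', by omega, hx'⟩

theorem IsUniversalPrefixMachine.exists_shortest {U : List Bool → ℕ →. ℕ}
    (hU : IsUniversalPrefixMachine U) (x y : ℕ) :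
    ∃ p : List Bool, p.length = condK U x y ∧ x ∈ U p y := by
  obtain ⟨c, hc⟩ := hU.exists_program
  obtain ⟨q, -, hq⟩ := hc x y
  exact Nat.sInf_mem (s := {n | ∃ p : List Bool, p.length = n ∧ x ∈ U p y}) ⟨_, q, rfl, hq⟩

/-- Kraft–Chaitin theorem, uniformly in a parameter `a`: the requests made in the context of a
parameter `a` and a condition `y` are met up to the complexity of `a`. -/
theorem IsUniversalPrefixMachine.condK_le_of_request {U : List Bool → ℕ →. ℕ}
    (hU : IsUniversalPrefixMachine U) {req : ℕ × ℕ → ℕ → Option (ℕ × ℕ)} (hreq : Primrec₂ req) :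
    ∃ c : ℕ, ∀ a y, (∀ N, ∑ s ∈ Finset.range N, reqWeight (req (a, y) s) ≤ 1) →
      ∀ t x ℓ, req (a, y) t = some (x, ℓ) → condK U x y ≤ prefixK U a + ℓ + c := by
  obtain ⟨G, hG, -, -, hGmem⟩ := exists_stages hU.isPrefixMachine.partrec
  -- The machine reads a `U`-program for `a` followed by a codeword; `k` guesses the split point,
  -- the running time of `U` and the time of the request.
  set step : List Bool × ℕ → ℕ → Option ℕ := fun z k =>
    (G (z.1.take k.unpair.1, 0) k.unpair.2.unpair.1).bind fun a =>
      decodeWord (req (a, z.2)) (z.1.drop k.unpair.1) k.unpair.2.unpair.2 with hstep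
  have hstepp : Primrec₂ step := by
    have k1 : Primrec fun z : (List Bool × ℕ) × ℕ => z.2.unpair.1 :=
      Primrec.fst.comp (Primrec.unpair.comp Primrec.snd)
    have k2 : Primrec fun z : (List Bool × ℕ) × ℕ => z.2.unpair.2.unpair :=
      Primrec.unpair.comp (Primrec.snd.comp (Primrec.unpair.comp Primrec.snd))
    have p : Primrec fun z : (List Bool × ℕ) × ℕ => z.1.1 := Primrec.fst.comp Primrec.fst
    refine Primrec.option_bind (hG.comp ((Primrec.list_take.comp k1 p).pair (Primrec.const 0))
      (Primrec.fst.comp k2)) ?_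
    exact (primrec_decodeWord hreq).comp
      ((Primrec.snd.pair (Primrec.snd.comp (Primrec.fst.comp Primrec.fst))).pair
        ((Primrec.list_drop.comp (k1.comp Primrec.fst) (p.comp Primrec.fst)).pair
          (Primrec.snd.comp (k2.comp Primrec.fst))))
  have hspec : ∀ r y k x, x ∈ step (r, y) k → ∃ p q a t, p ++ q = r ∧ a ∈ U p 0 ∧
      x ∈ decodeWord (req (a, y)) q t := by
    intro r y k x h
    simp only [hstep, Option.mem_def, Option.bind_eq_some_iff] at h
    obtain ⟨a, ha, hx⟩ := h
    exact ⟨_, _, a, _, List.take_append_drop _ _, (hGmem (r.take k.unpair.1, 0) a).2 ⟨_, ha⟩, hx⟩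
  -- Prefix-freeness of `U` forces the same split and the same `a`, which leaves two comparable
  -- codewords for one stream.
  have hunique : ∀ y r r' k k' x x', x ∈ step (r, y) k → x' ∈ step (r', y) k' → r <+: r' →
      r = r' ∧ x = x' := by
    intro y r r' k k' x x' h h' hr
    obtain ⟨p, q, a, t, rfl, hp, hx⟩ := hspec _ _ _ _ h
    obtain ⟨p', q', a', t', rfl, hp', hx'⟩ := hspec _ _ _ _ h'
    have hpp : p = p' := by
      rcases List.prefix_or_prefix_of_prefix ((List.prefix_append p q).trans hr)
        (List.prefix_append p' q') with h0 | h0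
      · exact hU.isPrefixMachine.prefixFree 0 _ _ (Part.dom_iff_mem.2 ⟨_, hp⟩)
          (Part.dom_iff_mem.2 ⟨_, hp'⟩) h0
      · exact (hU.isPrefixMachine.prefixFree 0 _ _ (Part.dom_iff_mem.2 ⟨_, hp'⟩)
          (Part.dom_iff_mem.2 ⟨_, hp⟩) h0).symm
    subst hpp
    obtain rfl := Part.mem_unique hp hp'
    obtain ⟨rfl, rfl⟩ := decodeWord_prefixFree hx hx' ((List.prefix_append_right_inj p).1 hr)
    exact ⟨rfl, rfl⟩
  obtain ⟨c, hc⟩ := hU.universal (fun r y => Nat.rfindOpt (step (r, y)))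
    { partrec := Partrec.rfindOpt hstepp.to_comp
      prefixFree := by
        intro y p q h1 h2 hpq
        obtain ⟨t, x, h1⟩ := Nat.rfindOpt_dom.1 h1
        obtain ⟨t', x', h2⟩ := Nat.rfindOpt_dom.1 h2
        exact (hunique y _ _ _ _ _ _ h1 h2 hpq).1 }
  refine ⟨c + 1, fun a y hsum t x ℓ ht => ?_⟩
  obtain ⟨p, hp, hpa⟩ := hU.exists_shortest a 0
  obtain ⟨q, hq, hqx⟩ := exists_decodeWord ht (hsum _)
  obtain ⟨s, hs⟩ := (hGmem (p, 0) a).1 hpa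
  have hk : x ∈ step (p ++ q, y) (Nat.pair p.length (Nat.pair s t)) := by
    simp only [Option.mem_def] at hs hqx
    simp [hstep, hs, hqx]
  have hmem : x ∈ Nat.rfindOpt (step (p ++ q, y)) := by
    have hd : (Nat.rfindOpt (step (p ++ q, y))).Dom := Nat.rfindOpt_dom.2 ⟨_, _, hk⟩
    obtain ⟨t, ht⟩ := Nat.rfindOpt_spec (Part.get_mem hd)
    rw [(hunique _ _ _ _ _ _ _ hk ht List.prefix_rfl).2]
    exact Part.get_mem hd
  obtain ⟨q', hq', hx'⟩ := hc _ _ _ hmem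
  have := condK_le hx'
  rw [List.length_append] at hq'
  unfold prefixK
  omega

/-- Every recursively enumerable family of sets of pairs has a primitive recursive enumeration
without repetitions. -/
theorem exists_requests {α σ : Type*} [Primcodable α] [Primcodable σ] {h : α × (ℕ × ℕ) →. σ}
    (hh : Partrec h) :
    ∃ req : α → ℕ → Option (ℕ × ℕ), Primrec₂ req ∧
      (∀ a r, (∃ t, req a t = some r) ↔ (h (a, r)).Dom) ∧
      ∀ a t t' r, req a t = some r → req a t' = some r → t = t' := by
  obtain ⟨F, hF, hF0, hFmono, hFmem⟩ := exists_stages hh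
  -- Time `t` codes a pair `r` and a stage `n`; `r` is issued only if stage `n + 1` is the first to
  -- succeed, which rules out repetitions. Stage `0` never succeeds, so no first success is missed.
  have hreq : ∀ (a : α) (t : ℕ) (r : ℕ × ℕ), (if (F (a, t.unpair.1.unpair) (t.unpair.2 + 1)).isSome = true ∧
      (F (a, t.unpair.1.unpair) t.unpair.2).isSome = false then some t.unpair.1.unpair else none)
      = some r ↔ (F (a, r) (t.unpair.2 + 1)).isSome = true ∧ (F (a, r) t.unpair.2).isSome = false ∧
        t.unpair.1.unpair = r := by
    intro a t r
    simp only [Option.ite_none_right_eq_some, Option.some.injEq]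
    constructor
    · rintro ⟨⟨h1, h2⟩, rfl⟩
      exact ⟨h1, h2, rfl⟩
    · rintro ⟨h1, h2, rfl⟩
      exact ⟨⟨h1, h2⟩, rfl⟩
  have hmono : ∀ z s t, s ≤ t → (F z s).isSome = true → (F z t).isSome = true := by
    intro z s t hst h
    obtain ⟨b, hb⟩ := Option.isSome_iff_exists.1 h
    exact Option.isSome_iff_exists.2 ⟨b, hFmono z s t b hst hb⟩
  refine ⟨fun a t => if (F (a, t.unpair.1.unpair) (t.unpair.2 + 1)).isSome = true ∧
      (F (a, t.unpair.1.unpair) t.unpair.2).isSome = false then some t.unpair.1.unpair else none,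
    ?_, ?_, ?_⟩
  · have i : Primrec fun z : α × ℕ => z.2.unpair.1.unpair :=
      Primrec.unpair.comp (Primrec.fst.comp (Primrec.unpair.comp Primrec.snd))
    have s : Primrec fun z : α × ℕ => z.2.unpair.2 :=
      Primrec.snd.comp (Primrec.unpair.comp Primrec.snd)
    exact Primrec.ite
      ((Primrec.eq.comp (Primrec.option_isSome.comp
          (hF.comp (Primrec.fst.pair i) (Primrec.succ.comp s))) (Primrec.const true)).and
        (Primrec.eq.comp (Primrec.option_isSome.comp (hF.comp (Primrec.fst.pair i) s))
          (Primrec.const false)))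
      (Primrec.option_some.comp i) (Primrec.const none)
  · intro a r
    simp only [hreq]
    constructor
    · rintro ⟨t, h1, -, -⟩
      obtain ⟨b, hb⟩ := Option.isSome_iff_exists.1 h1
      exact Part.dom_iff_mem.2 ⟨b, (hFmem _ _).2 ⟨_, hb⟩⟩
    · intro hd
      obtain ⟨b, hb⟩ := Part.dom_iff_mem.1 hd
      obtain ⟨s, hs⟩ := (hFmem _ _).1 hb
      have hex : ∃ s, (F (a, r) s).isSome = true := ⟨s, Option.isSome_iff_exists.2 ⟨b, hs⟩⟩
      classical
      obtain ⟨n, hn⟩ : ∃ n, Nat.find hex = n + 1 := by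
        refine Nat.exists_eq_succ_of_ne_zero fun h0 => ?_
        have := Nat.find_spec hex
        rw [h0, hF0] at this
        simp at this
      refine ⟨Nat.pair (Nat.pair r.1 r.2) n, ?_, ?_, ?_⟩
      · simpa [hn] using Nat.find_spec hex
      · simpa using Nat.find_min hex (m := n) (by omega)
      · simp
  · intro a t t' r h h'
    rw [hreq] at h h'
    have key : t.unpair.2 = t'.unpair.2 := by
      rcases lt_trichotomy t.unpair.2 t'.unpair.2 with hlt | heq | hlt
      · have := hmono _ _ _ (Nat.succ_le_of_lt hlt) h.1
        simp [this] at h'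
      · exact heq
      · have := hmono _ _ _ (Nat.succ_le_of_lt hlt) h'.1
        simp [this] at h
    have k1 : t.unpair.1 = t'.unpair.1 := by
      rw [← Nat.pair_unpair t.unpair.1, ← Nat.pair_unpair t'.unpair.1, h.2.2, h'.2.2]
    rw [← Nat.pair_unpair t, ← Nat.pair_unpair t', key, k1]

/-- Distinct powers of 1/2 sum to at most twice the largest, by the geometric series. -/
theorem sum_inv_two_pow_le (L : Finset ℕ) {r : ℝ} (hr : 0 ≤ r)
    (h : ∀ ℓ ∈ L, 2 * (2 : ℝ)⁻¹ ^ ℓ ≤ r) : ∑ ℓ ∈ L, (2 : ℝ)⁻¹ ^ ℓ ≤ r := by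
  rcases L.eq_empty_or_nonempty with rfl | hne
  · simpa using hr
  · have hIco : ∀ n k, ∑ ℓ ∈ Finset.Ico n (n + k), (2 : ℝ)⁻¹ ^ ℓ =
        2 * (2 : ℝ)⁻¹ ^ n - 2 * (2 : ℝ)⁻¹ ^ (n + k) := by
      intro n k
      induction k with
      | zero => simp
      | succ k ih =>
        rw [← add_assoc, Finset.sum_Ico_succ_top (by omega), ih, pow_succ (2 : ℝ)⁻¹ (n + k)]
        ring
    refine le_trans ?_ (h _ (L.min'_mem hne))
    have hsub : L ⊆ Finset.Ico (L.min' hne) (L.min' hne + (L.max' hne + 1)) := by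
      intro ℓ hℓ
      have := L.min'_le ℓ hℓ
      have := L.le_max' ℓ hℓ
      rw [Finset.mem_Ico]
      omega
    refine (Finset.sum_le_sum_of_subset_of_nonneg hsub fun _ _ _ => by positivity).trans ?_
    rw [hIco]
    linarith [pow_pos (by norm_num : (0 : ℝ) < 2⁻¹) (L.min' hne + (L.max' hne + 1))]

theorem IsDistribution.le_one {f : ℕ → ℝ} (hf : IsDistribution f) (x : ℕ) : f x ≤ 1 :=
  (hf.summable.le_tsum x fun _ _ => hf.nonneg _).trans hf.tsum_le_one

/-- For each `x` the requested lengths are distinct, so their weights sum to at most `f x`; then sum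
over `x`. -/
theorem sum_reqWeight_le_one {f : ℕ → ℝ} (hf : IsDistribution f) {req : ℕ → Option (ℕ × ℕ)}
    (hinj : ∀ t t' r, req t = some r → req t' = some r → t = t')
    (hle : ∀ t x ℓ, req t = some (x, ℓ) → 2 * (2 : ℝ)⁻¹ ^ ℓ ≤ f x) (N : ℕ) :
    ∑ s ∈ Finset.range N, reqWeight (req s) ≤ 1 := by
  classical
  set T := (Finset.range N).filter fun s => (req s).isSome = true with hT
  set g : ℕ → ℕ × ℕ := fun s => (req s).getD (0, 0) with hg
  have hgT : ∀ s ∈ T, req s = some (g s) := by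
    intro s hs
    obtain ⟨r, hr⟩ := Option.isSome_iff_exists.1 (Finset.mem_filter.1 hs).2
    simp [hg, hr]
  have h1 : ∑ s ∈ Finset.range N, reqWeight (req s) = ∑ s ∈ T, (2 : ℝ)⁻¹ ^ (g s).2 := by
    rw [hT, Finset.sum_filter]
    refine Finset.sum_congr rfl fun s _ => ?_
    cases h : req s <;> simp [reqWeight, hg, h]
  have h2 : ∑ s ∈ T, (2 : ℝ)⁻¹ ^ (g s).2 = ∑ r ∈ T.image g, (2 : ℝ)⁻¹ ^ r.2 := by
    refine (Finset.sum_image (f := fun r : ℕ × ℕ => (2 : ℝ)⁻¹ ^ r.2) fun s hs s' hs' he => ?_).symm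
    exact hinj s s' (g s) (hgT s hs) (he ▸ hgT s' hs')
  have hR : ∀ r ∈ T.image g, 2 * (2 : ℝ)⁻¹ ^ r.2 ≤ f r.1 := by
    intro r hr
    obtain ⟨s, hs, rfl⟩ := Finset.mem_image.1 hr
    exact hle s _ _ (hgT s hs)
  rw [h1, h2, ← Finset.sum_fiberwise_of_maps_to (g := Prod.fst)
    (fun r hr => Finset.mem_image_of_mem Prod.fst hr)]
  refine (Finset.sum_le_sum fun x _ => ?_).trans
    ((hf.summable.sum_le_tsum _ fun _ _ => hf.nonneg _).trans hf.tsum_le_one)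
  rw [← Finset.sum_image (f := fun ℓ : ℕ => (2 : ℝ)⁻¹ ^ ℓ) (g := Prod.snd)]
  · refine sum_inv_two_pow_le _ (hf.nonneg x) fun ℓ hℓ => ?_
    obtain ⟨r, hr, rfl⟩ := Finset.mem_image.1 hℓ
    obtain ⟨hr', rfl⟩ := Finset.mem_filter.1 hr
    exact hR r hr'
  · intro r hr r' hr' he
    have e1 := (Finset.mem_filter.1 hr).2
    have e2 := (Finset.mem_filter.1 hr').2
    exact Prod.ext (e1.trans e2.symm) he

/-! ### Coding theorem for lower approximable distributions -/

/-- The fractions `v.1 / v.2` produced by the partial sequence `g` have supremum `r`. -/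
def LowerApproximates (g : ℕ →. ℕ × ℕ) (r : ℝ) : Prop :=
  (∀ s v, v ∈ g s → 0 < v.2 ∧ (v.1 : ℝ) / v.2 ≤ r) ∧
    ∀ q < r, ∃ s v, v ∈ g s ∧ q < (v.1 : ℝ) / v.2

theorem two_mul_inv_pow_lt_iff (v : ℕ × ℕ) (hv : 0 < v.2) (ℓ : ℕ) :
    2 * (2 : ℝ)⁻¹ ^ ℓ < (v.1 : ℝ) / v.2 ↔ 2 * v.2 < v.1 * 2 ^ ℓ := by
  have : (0 : ℝ) < v.2 := by exact_mod_cast hv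
  rw [← @Nat.cast_lt ℝ, lt_div_iff₀ this, inv_pow, ← div_eq_mul_inv, div_mul_eq_mul_div,
    div_lt_iff₀ (by positivity)]
  push_cast
  rfl

/-- Request `(x, ℓ)` as soon as a lower approximation of `f x` exceeds `2 * 2^(-ℓ)`. The shortest
length so requested for `x` is within 2 of `-log f x`. -/
theorem IsUniversalPrefixMachine.condK_le_neg_logb {U : List Bool → ℕ →. ℕ}
    (hU : IsUniversalPrefixMachine U) {A : (ℕ × ℕ) × (ℕ × ℕ) →. ℕ × ℕ} (hA : Partrec A) :
    ∃ c : ℝ, ∀ (a y : ℕ) (f : ℕ → ℝ), IsDistribution f →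
      (∀ x, LowerApproximates (fun s => A ((a, y), (x, s))) (f x)) →
      ∀ x, 0 < f x → (condK U x y : ℝ) ≤ -Real.logb 2 (f x) + prefixK U a + c := by
  obtain ⟨G, hG, -, -, hGmem⟩ := exists_stages hA
  set test : (ℕ × ℕ) × (ℕ × ℕ) → ℕ → Option Unit := fun z k =>
    (G (z.1, (z.2.1, k.unpair.1)) k.unpair.2).bind fun v =>
      if 2 * v.2 < v.1 * 2 ^ z.2.2 then some () else none with htest
  have hprim : Primrec₂ test := by
    have k : Primrec fun z : ((ℕ × ℕ) × (ℕ × ℕ)) × ℕ => z.2.unpair :=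
      Primrec.unpair.comp Primrec.snd
    refine Primrec.option_bind (hG.comp ((Primrec.fst.comp Primrec.fst).pair
      ((Primrec.fst.comp (Primrec.snd.comp Primrec.fst)).pair (Primrec.fst.comp k)))
      (Primrec.snd.comp k)) ?_
    exact Primrec.ite (Primrec.nat_lt.comp
      (Primrec.nat_mul.comp (Primrec.const 2) (Primrec.snd.comp Primrec.snd))
      (Primrec.nat_mul.comp (Primrec.fst.comp Primrec.snd) (primrec_two_pow.comp
        (Primrec.snd.comp (Primrec.snd.comp (Primrec.fst.comp Primrec.fst))))))
      (Primrec.const _) (Primrec.const _)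
  obtain ⟨req, hreq, hdom, hinj⟩ := exists_requests (Partrec.rfindOpt hprim.to_comp)
  have hdom' : ∀ a y x ℓ, (∃ t, req (a, y) t = some (x, ℓ)) ↔
      ∃ s v, v ∈ A ((a, y), (x, s)) ∧ 2 * v.2 < v.1 * 2 ^ ℓ := by
    intro a y x ℓ
    rw [hdom, Nat.rfindOpt_dom]
    simp only [htest, Option.mem_def, Option.bind_eq_some_iff, Option.ite_none_right_eq_some]
    constructor
    · rintro ⟨k, _, v, hv, hlt, -⟩
      exact ⟨_, v, (hGmem _ _).2 ⟨_, hv⟩, hlt⟩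
    · rintro ⟨s, v, hv, hlt⟩
      obtain ⟨n, hn⟩ := (hGmem _ _).1 hv
      exact ⟨Nat.pair s n, (), v, by simpa using hn, hlt, trivial⟩
  obtain ⟨c, hc⟩ := hU.condK_le_of_request hreq
  refine ⟨c + 2, fun a y f hf hA x hx => ?_⟩
  have hsum : ∀ N, ∑ s ∈ Finset.range N, reqWeight (req (a, y) s) ≤ 1 := by
    refine sum_reqWeight_le_one hf (hinj (a, y)) fun t x ℓ ht => ?_
    obtain ⟨s, v, hv, hlt⟩ := (hdom' a y x ℓ).1 ⟨t, ht⟩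
    obtain ⟨hpos, hle⟩ := (hA x).1 s v hv
    exact ((two_mul_inv_pow_lt_iff v hpos ℓ).2 hlt).le.trans hle
  have hlog : 0 ≤ -Real.logb 2 (f x) :=
    neg_nonneg.2 (Real.logb_nonpos (by norm_num) hx.le (hf.le_one x))
  -- The least integer with `2 * 2^(-ℓ) < f x`.
  set ℓ := ⌊-Real.logb 2 (f x)⌋₊ + 2 with hℓ
  have hℓ1 : -Real.logb 2 (f x) + 1 < ℓ := by
    have := Nat.lt_floor_add_one (-Real.logb 2 (f x))
    rw [hℓ]
    push_cast
    linarith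
  have hℓ2 : (ℓ : ℝ) ≤ -Real.logb 2 (f x) + 2 := by
    have := Nat.floor_le hlog
    rw [hℓ]
    push_cast
    linarith
  have hlt : 2 * (2 : ℝ)⁻¹ ^ ℓ < f x := by
    have h1 : (2 : ℝ) ^ (1 - ℓ : ℝ) < f x := by
      rw [← Real.lt_logb_iff_rpow_lt (by norm_num) hx]
      linarith
    rwa [Real.rpow_sub (by norm_num), Real.rpow_one, Real.rpow_natCast, div_eq_mul_inv,
      ← inv_pow] at h1
  obtain ⟨s, v, hv, hvlt⟩ := (hA x).2 _ hlt
  obtain ⟨t, ht⟩ := (hdom' a y x ℓ).2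
    ⟨s, v, hv, (two_mul_inv_pow_lt_iff v ((hA x).1 s v hv).1 ℓ).1 hvlt⟩
  have hfin : (condK U x y : ℝ) ≤ prefixK U a + ℓ + c := by
    exact_mod_cast hc a y hsum t x ℓ ht
  linarith

/-- The coding theorem: `K(x | y) ≤ - log m(x | y) + O(1)`. -/
theorem IsUniversalPrefixMachine.condK_le_neg_logb_universal {U : List Bool → ℕ →. ℕ}
    (hU : IsUniversalPrefixMachine U) {m : ℕ → ℕ → ℝ} (hm : IsUniversalDist m) :
    ∃ c : ℝ, ∀ x y, 0 < m x y → (condK U x y : ℝ) ≤ -Real.logb 2 (m x y) + c := by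
  obtain ⟨φ, hφ, hpos, hlim⟩ := hm.enumerable
  have hA : Partrec fun z : (ℕ × ℕ) × (ℕ × ℕ) => Part.some (φ (z.2.1, z.1.2, z.2.2)) :=
    (hφ.comp ((Computable.fst.comp Computable.snd).pair ((Computable.snd.comp Computable.fst).pair
      (Computable.snd.comp Computable.snd)))).partrec
  obtain ⟨c, hc⟩ := hU.condK_le_neg_logb hA
  -- `m` is a single fixed function, so the parameter is a dummy and its complexity joins the
  -- constant.
  refine ⟨prefixK U 0 + c, fun x y hx => ?_⟩
  have := hc 0 y (fun x => m x y) (hm.isDistribution y) (fun x => ?_) x hx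
  · linarith
  · obtain ⟨hmono, htend⟩ := hlim x y
    constructor
    · intro s v hv
      obtain rfl := Part.mem_some_iff.1 hv
      exact ⟨hpos _, hmono.ge_of_tendsto htend s⟩
    · intro q hq
      obtain ⟨s, hs⟩ := (htend.eventually_const_lt hq).exists
      exact ⟨s, _, Part.mem_some _, hs⟩

/-- Subtracting the allowed error `2^(-b)` turns the `b`-th fraction into a lower bound within `2 *
2^(-b)` of `r`. Truncation of negative numerators to `0` is harmless since `0 ≤ r`. -/
theorem lowerApproximates_of_computes {g : ℕ →. ℕ} {r : ℝ} (hr : 0 ≤ r)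
    (h : ∀ b, ∃ p q : ℕ, Nat.pair p q ∈ g b ∧ 0 < q ∧ |r - (p : ℝ) / q| ≤ (2 : ℝ)⁻¹ ^ b) :
    LowerApproximates (fun b => (g b).map fun v =>
      (v.unpair.1 * 2 ^ b - v.unpair.2, v.unpair.2 * 2 ^ b)) r := by
  have hfrac : ∀ p q b : ℕ, 0 < q →
      ((p : ℝ) * 2 ^ b - q) / (q * 2 ^ b) = p / q - (2 : ℝ)⁻¹ ^ b := by
    intro p q b hq
    have : (q : ℝ) ≠ 0 := by positivity
    rw [inv_pow]
    field_simp
  constructor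
  · intro b v hv
    obtain ⟨p, q, hpq, hq, habs⟩ := h b
    obtain ⟨w, hw, rfl⟩ := (Part.mem_map_iff _).1 hv
    obtain rfl := Part.mem_unique hpq hw
    simp only [Nat.unpair_pair]
    refine ⟨by positivity, ?_⟩
    rcases le_total q (p * 2 ^ b) with hle | hle
    · rw [Nat.cast_sub hle]
      push_cast
      rw [hfrac p q b hq]
      linarith [(abs_le.1 habs).1]
    · rw [Nat.sub_eq_zero_of_le hle]
      simpa using hr
  · intro x hx
    obtain ⟨b, hb⟩ := exists_pow_lt_of_lt_one (half_pos (sub_pos.2 hx))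
      (by norm_num : (2 : ℝ)⁻¹ < 1)
    obtain ⟨p, q, hpq, hq, habs⟩ := h b
    refine ⟨b, _, Part.mem_map _ hpq, ?_⟩
    simp only [Nat.unpair_pair]
    have hq' : (0 : ℝ) < q := by exact_mod_cast hq
    have h1 : (p : ℝ) * 2 ^ b - q ≤ ((p * 2 ^ b - q : ℕ) : ℝ) := by
      rw [sub_le_iff_le_add]
      exact_mod_cast (le_tsub_add : p * 2 ^ b ≤ p * 2 ^ b - q + q)
    have h2 := div_le_div_of_nonneg_right h1 (by positivity : (0 : ℝ) ≤ q * 2 ^ b)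
    rw [hfrac p q b hq] at h2
    push_cast
    linarith [(abs_le.1 habs).2]

/-- The index of `e` serves as the parameter. The map `idx` covers both codes that ignore the
condition and codes of a joint function that read it. -/
theorem IsUniversalPrefixMachine.condK_le_neg_logb_of_code {U : List Bool → ℕ →. ℕ}
    (hU : IsUniversalPrefixMachine U) {idx : ℕ → ℕ → ℕ} (hidx : Computable₂ idx) :
    ∃ c : ℝ, ∀ (e : Nat.Partrec.Code) (y : ℕ) (f : ℕ → ℝ), IsDistribution f →
      (∀ x b, ∃ p q : ℕ, Nat.pair p q ∈ e.eval (Nat.pair (idx x y) b) ∧ 0 < q ∧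
        |f x - (p : ℝ) / q| ≤ (2 : ℝ)⁻¹ ^ b) →
      ∀ x, 0 < f x →
        (condK U x y : ℝ) ≤ -Real.logb 2 (f x) + prefixK U (Encodable.encode e) + c := by
  have hA : Partrec fun z : (ℕ × ℕ) × (ℕ × ℕ) =>
      ((Denumerable.ofNat Nat.Partrec.Code z.1.1).eval
        (Nat.pair (idx z.2.1 z.1.2) z.2.2)).map fun v : ℕ =>
          (v.unpair.1 * 2 ^ z.2.2 - v.unpair.2, v.unpair.2 * 2 ^ z.2.2) := by
    refine Partrec.map (Nat.Partrec.Code.eval_part.comp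
      ((Computable.ofNat _).comp (Computable.fst.comp Computable.fst))
      (Primrec₂.natPair.to_comp.comp
        (hidx.comp (Computable.fst.comp Computable.snd) (Computable.snd.comp Computable.fst))
        (Computable.snd.comp Computable.snd))) (Primrec.to_comp ?_)
    have v : Primrec fun w : ((ℕ × ℕ) × (ℕ × ℕ)) × ℕ => w.2.unpair :=
      Primrec.unpair.comp Primrec.snd
    have k : Primrec fun w : ((ℕ × ℕ) × (ℕ × ℕ)) × ℕ => 2 ^ w.1.2.2 :=
      primrec_two_pow.comp (Primrec.snd.comp (Primrec.snd.comp Primrec.fst))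
    exact (Primrec.nat_sub.comp (Primrec.nat_mul.comp (Primrec.fst.comp v) k)
      (Primrec.snd.comp v)).pair (Primrec.nat_mul.comp (Primrec.snd.comp v) k)
  obtain ⟨c, hc⟩ := hU.condK_le_neg_logb hA
  refine ⟨c, fun e y f hf he x hx => hc (Encodable.encode e) y f hf (fun x => ?_) x hx⟩
  simp only [Denumerable.ofNat_encode]
  exact lowerApproximates_of_computes (g := fun b => e.eval (Nat.pair (idx x y) b))
    (hf.nonneg x) (he x)

/-- Shannon–Fano coding: `K(x | y) ≤ - log P(x) + K(P) + O(1)`, uniformly in the recursive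
distribution `P`. -/
theorem IsUniversalPrefixMachine.condK_le_neg_logb_add_distK {U : List Bool → ℕ →. ℕ}
    (hU : IsUniversalPrefixMachine U) :
    ∃ c : ℝ, ∀ P, IsRecursiveDist P → ∀ x y, 0 < P x →
      (condK U x y : ℝ) ≤ -Real.logb 2 (P x) + distK U P + c := by
  obtain ⟨c, hc⟩ := hU.condK_le_neg_logb_of_code (idx := fun x _ => x) Computable.fst
  refine ⟨c, fun P hP x y hx => ?_⟩
  obtain ⟨e₀, he₀⟩ := hP.2
  obtain ⟨e, he, hK⟩ := Nat.sInf_mem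
    (s := {n | ∃ e : Nat.Partrec.Code, ComputesReal e P ∧ n = prefixK U (Encodable.encode e)})
    ⟨_, e₀, he₀, rfl⟩
  have := hc e y P hP.1 he x hx
  rwa [← hK] at this

/-- Shannon–Fano coding for a fixed recursive conditional distribution. -/
theorem IsUniversalPrefixMachine.condK_le_neg_logb_cond {U : List Bool → ℕ →. ℕ}
    (hU : IsUniversalPrefixMachine U) {Pr : ℕ → ℕ → ℝ} (hPr : IsRecursiveCondDist Pr) :
    ∃ c : ℝ, ∀ x y, 0 < Pr x y → (condK U x y : ℝ) ≤ -Real.logb 2 (Pr x y) + c := by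
  obtain ⟨c, hc⟩ := hU.condK_le_neg_logb_of_code (idx := Nat.pair) Primrec₂.natPair.to_comp
  obtain ⟨hdist, e, he⟩ := hPr
  refine ⟨prefixK U (Encodable.encode e) + c, fun x y hx => ?_⟩
  have := hc e y (fun x => Pr x y) (hdist y)
    (fun x b => by simpa using he (Nat.pair x y) b) x hx
  linarith

theorem IsRecursiveCondDist.isRecursiveDist {Pr : ℕ → ℕ → ℝ} (h : IsRecursiveCondDist Pr)
    (y : ℕ) : IsRecursiveDist fun x => Pr x y := by
  obtain ⟨hdist, e, he⟩ := h
  refine ⟨hdist y, ?_⟩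
  have hp : Partrec fun n : ℕ => e.eval (Nat.pair (Nat.pair n.unpair.1 y) n.unpair.2) :=
    Nat.Partrec.Code.eval_part.comp (Computable.const e)
      (Primrec.to_comp (Primrec₂.natPair.comp
        (Primrec₂.natPair.comp (Primrec.fst.comp Primrec.unpair) (Primrec.const y))
        (Primrec.snd.comp Primrec.unpair)))
  obtain ⟨e', he'⟩ := Nat.Partrec.Code.exists_code.1 (Partrec.nat_iff.1 hp)
  refine ⟨e', fun x b => ?_⟩
  rw [he']
  simpa using he (Nat.pair x y) b

/-! ### The universal distribution dominates `2 ^ (-K)` -/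

/-- Shortest programs of distinct outputs form a prefix-free set, so Kraft's inequality applies. -/
theorem IsUniversalPrefixMachine.isDistribution_two_pow_condK {U : List Bool → ℕ →. ℕ}
    (hU : IsUniversalPrefixMachine U) (y : ℕ) :
    IsDistribution fun x => (2 : ℝ)⁻¹ ^ condK U x y := by
  choose p hp hpx using fun x => hU.exists_shortest x y
  have hinj : Function.Injective p := by
    intro x x' h
    exact Part.mem_unique (hpx x) (h ▸ hpx x')
  have hsum : ∀ F : Finset ℕ, ∑ x ∈ F, (2 : ℝ)⁻¹ ^ condK U x y ≤ 1 := by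
    intro F
    have := kraft_inequality (F.map ⟨p, hinj⟩) (by
      intro q hq q' hq' hpre
      obtain ⟨x, -, rfl⟩ := Finset.mem_map.1 hq
      obtain ⟨x', -, rfl⟩ := Finset.mem_map.1 hq'
      exact hU.isPrefixMachine.prefixFree y _ _ (Part.dom_iff_mem.2 ⟨_, hpx x⟩)
        (Part.dom_iff_mem.2 ⟨_, hpx x'⟩) hpre)
    rw [Finset.sum_map] at this
    simpa [hp] using this
  have hnn : ∀ x, 0 ≤ (2 : ℝ)⁻¹ ^ condK U x y := fun x => by positivity
  exact ⟨hnn, summable_of_sum_le hnn hsum, Real.tsum_le_of_sum_le hnn hsum⟩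

theorem IsUniversalPrefixMachine.isEnumerable_two_pow_condK {U : List Bool → ℕ →. ℕ}
    (hU : IsUniversalPrefixMachine U) :
    IsEnumerable fun x y => (2 : ℝ)⁻¹ ^ condK U x y := by
  obtain ⟨G, hG, -, -, hGmem⟩ := exists_stages hU.isPrefixMachine.partrec
  obtain ⟨c, hc⟩ := hU.exists_program
  set hit : ℕ × ℕ → ℕ → Option ℕ := fun z t =>
    (Encodable.decode (α := List Bool) t.unpair.1).bind fun p =>
      if G (p, z.2) t.unpair.2 = some z.1 then some p.length else none with hhit
  have hhitp : Primrec₂ hit := by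
    have k : Primrec fun z : (ℕ × ℕ) × ℕ => z.2.unpair := Primrec.unpair.comp Primrec.snd
    refine Primrec.option_bind (Primrec.decode.comp (Primrec.fst.comp k)) ?_
    exact Primrec.ite (Primrec.eq.comp (hG.comp
        (Primrec.snd.pair (Primrec.snd.comp (Primrec.fst.comp Primrec.fst)))
        (Primrec.snd.comp (k.comp Primrec.fst)))
        (Primrec.option_some.comp (Primrec.fst.comp (Primrec.fst.comp Primrec.fst))))
      (Primrec.option_some.comp (Primrec.list_length.comp Primrec.snd)) (Primrec.const none)
  -- The length of the shortest program found so far by dovetailing, starting from the a priori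
  -- bound `x + c`; it decreases to `K`.
  set best : ℕ × ℕ → ℕ → ℕ := fun z t =>
    Nat.rec (z.1 + c) (fun t b => min b ((hit z t).getD b)) t with hbest
  have hbestp : Primrec₂ best := by
    have hstep : Primrec₂ fun (z : (ℕ × ℕ) × ℕ) (w : ℕ × ℕ) =>
        min w.2 ((hit z.1 w.1).getD w.2) :=
      Primrec.nat_min.comp (Primrec.snd.comp Primrec.snd)
        (Primrec.option_getD.comp (hhitp.comp (Primrec.fst.comp Primrec.fst)
          (Primrec.fst.comp Primrec.snd)) (Primrec.snd.comp Primrec.snd))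
    exact Primrec.nat_rec' Primrec.snd
      (Primrec.nat_add.comp (Primrec.fst.comp Primrec.fst) (Primrec.const c)) hstep
  have hanti : ∀ z, Antitone (best z) := fun z =>
    antitone_nat_of_succ_le fun t => min_le_left _ _
  have hge : ∀ x y t, condK U x y ≤ best (x, y) t := by
    intro x y t
    induction t with
    | zero =>
      obtain ⟨q, hq, hx⟩ := hc x y
      exact (condK_le hx).trans hq
    | succ t ih =>
      refine le_min ih ?_
      change condK U x y ≤ (hit (x, y) t).getD (best (x, y) t)
      cases h : hit (x, y) t with
      | none => simpa using ih
      | some n =>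
        simp only [hhit, Option.bind_eq_some_iff, Option.ite_none_right_eq_some,
          Option.some.injEq] at h
        obtain ⟨p, -, hp, rfl⟩ := h
        exact condK_le ((hGmem (p, y) x).2 ⟨_, hp⟩)
  have hev : ∀ x y, ∃ t₀, ∀ t ≥ t₀, best (x, y) t = condK U x y := by
    intro x y
    obtain ⟨p, hp, hpx⟩ := hU.exists_shortest x y
    obtain ⟨s, hs⟩ := (hGmem (p, y) x).1 hpx
    refine ⟨Nat.pair (Encodable.encode p) s + 1, fun t ht =>
      le_antisymm ((hanti _ ht).trans ?_) (hge x y t)⟩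
    refine (min_le_right _ _).trans_eq ?_
    simp only [Option.mem_def] at hs
    simp [hhit, hs, hp]
  have hval : ∀ n : ℕ, ((1 : ℕ) : ℝ) / ((2 ^ n : ℕ) : ℝ) = (2 : ℝ)⁻¹ ^ n := by
    intro n
    simp
  refine ⟨fun z => (1, 2 ^ best (z.1, z.2.1) z.2.2), Primrec.to_comp ?_,
    fun z => by positivity, fun x y => ?_⟩
  · exact (Primrec.const 1).pair (primrec_two_pow.comp (hbestp.comp
      (Primrec.fst.pair (Primrec.fst.comp Primrec.snd)) (Primrec.snd.comp Primrec.snd)))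
  · simp only [hval]
    refine ⟨fun t t' h => pow_le_pow_of_le_one (by norm_num) (by norm_num) (hanti _ h), ?_⟩
    obtain ⟨t₀, ht₀⟩ := hev x y
    exact tendsto_atTop_of_eventually_const (i₀ := t₀) fun t ht => by rw [ht₀ t ht]

theorem IsUniversalDist.neg_logb_le_condK {U : List Bool → ℕ →. ℕ}
    (hU : IsUniversalPrefixMachine U) {m : ℕ → ℕ → ℝ} (hm : IsUniversalDist m) :
    ∃ c : ℝ, ∀ x y, 0 < m x y ∧ -Real.logb 2 (m x y) ≤ condK U x y + c := by
  obtain ⟨c, hc, h⟩ := hm.universal _ hU.isDistribution_two_pow_condK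
    hU.isEnumerable_two_pow_condK
  refine ⟨Real.logb 2 c, fun x y => ?_⟩
  have hpos : (0 : ℝ) < 2⁻¹ ^ condK U x y := by positivity
  have hm0 : 0 < m x y := pos_of_mul_pos_right (hpos.trans_le (h x y)) hc.le
  refine ⟨hm0, ?_⟩
  have := Real.logb_le_logb_of_le (by norm_num : (1 : ℝ) < 2) hpos (h x y)
  rw [Real.logb_mul hc.ne' hm0.ne', Real.logb_pow, Real.logb_inv,
    Real.logb_self_eq_one (by norm_num)] at this
  linarith

/-! ### Extended-real tests and code lengths as real inequalities -/

theorem isRandom_iff {μ P : ℕ → ℝ} {d : ℝ} {x : ℕ} (hP : 0 ≤ P x) (hμ : 0 < μ x) :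
    IsRandom μ P d x ↔ 0 < P x ∧ Real.logb 2 (μ x) - Real.logb 2 (P x) ≤ d := by
  unfold IsRandom universalTest
  rcases hP.eq_or_lt with h | h
  · simp [← h]
  · rw [if_neg h.ne', EReal.coe_le_coe_iff, Real.logb_div hμ.ne' h.ne']
    simp [h]

theorem negLog_add_of_pos {p q : ℝ} (hp : 0 < p) (hq : 0 < q) :
    negLog p + negLog q = ((-Real.logb 2 p - Real.logb 2 q : ℝ) : EReal) := by
  rw [negLog, negLog, if_neg hp.ne', if_neg hq.ne', ← EReal.coe_add, ← sub_eq_add_neg]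

theorem ne_zero_of_negLog_add_le {p q r : ℝ} (h : negLog p + negLog q ≤ (r : EReal)) :
    p ≠ 0 ∧ q ≠ 0 := by
  unfold negLog at h
  constructor
  · rintro rfl
    rw [if_pos (rfl : (0 : ℝ) = 0)] at h
    split_ifs at h <;> simp at h
  · rintro rfl
    rw [if_pos (rfl : (0 : ℝ) = 0)] at h
    split_ifs at h <;> simp at h

end AlgMDL

theorem mainTheorem1
    (U : List Bool → ℕ →. ℕ) (hU : IsUniversalPrefixMachine U)
    (m : ℕ → ℕ → ℝ) (hm : IsUniversalDist m) :
    -- Part (i); the constant depends on neither of the two distributions.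
    (∃ c : ℝ, ∀ (Pr : ℕ → ℕ → ℝ) (P : ℕ → ℝ), IsRecursiveCondDist Pr → IsRecursiveDist P →
      ∀ (D H : ℕ) (d₁ d₂ : ℝ),
        IsRandom (fun x => m x H) (fun x => Pr x H) d₁ D →
        IsRandom (fun x => m x 0) P d₂ H →
        (((condK U D H : ℝ) + (prefixK U H : ℝ) - (alpha U Pr P H : ℝ) - c : ℝ) : EReal)
            ≤ negLog (Pr D H) + negLog (P H) ∧
        negLog (Pr D H) + negLog (P H)
            ≤ (((condK U D H : ℝ) + (prefixK U H : ℝ) + d₁ + d₂ + c : ℝ) : EReal)) ∧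
    -- Part (ii).
    (∀ (Pr : ℕ → ℕ → ℝ) (P : ℕ → ℝ), IsRecursiveCondDist Pr → IsRecursiveDist P →
      ∀ c : ℝ, ∃ d : ℝ, ∀ D H : ℕ,
        (((condK U D H : ℝ) + (prefixK U H : ℝ) - c : ℝ) : EReal)
            ≤ negLog (Pr D H) + negLog (P H) →
        negLog (Pr D H) + negLog (P H)
            ≤ (((condK U D H : ℝ) + (prefixK U H : ℝ) + c : ℝ) : EReal) →
        IsRandom (fun x => m x H) (fun x => Pr x H) d D ∧
        IsRandom (fun x => m x 0) P d H) := by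
  obtain ⟨c₁, hSF⟩ := hU.condK_le_neg_logb_add_distK
  obtain ⟨c₂, hmK⟩ := hm.neg_logb_le_condK hU
  obtain ⟨c₃, hcode⟩ := hU.condK_le_neg_logb_universal hm
  constructor
  -- Each estimate is used twice, for `D` given `H` and for `H`.
  · refine ⟨2 * |c₁| + 2 * |c₂|, fun Pr P hPr hP D H d₁ d₂ hD hH => ?_⟩
    obtain ⟨hD0, hD⟩ := (isRandom_iff ((hPr.1 H).nonneg D) (hmK D H).1).1 hD
    obtain ⟨hH0, hH⟩ := (isRandom_iff (hP.1.nonneg H) (hmK H 0).1).1 hH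
    have h1 := hSF _ (hPr.isRecursiveDist H) D H hD0
    have h2 := hSF P hP H 0 hH0
    have h3 := (hmK D H).2
    have h4 := (hmK H 0).2
    have hc₁ := le_abs_self c₁
    have hc₂ := le_abs_self c₂
    have hc₁' := abs_nonneg c₁
    have hc₂' := abs_nonneg c₂
    rw [negLog_add_of_pos hD0 hH0, EReal.coe_le_coe_iff, EReal.coe_le_coe_iff]
    simp only [alpha, prefixK]
    push_cast
    constructor <;> linarith
  · intro Pr P hPr hP c
    -- Here `H` is read from the condition, so `c₄` is independent of `H`; the bound through
    -- `K(Pr(·|H))` would not be uniform.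
    obtain ⟨c₄, hcond⟩ := hU.condK_le_neg_logb_cond hPr
    -- The deficiency of `D` absorbs the Shannon–Fano slack of `H`, and vice versa: hence the
    -- maximum.
    refine ⟨c + c₃ + max (distK U P + c₁) c₄, fun D H _ hup => ?_⟩
    obtain ⟨hD0, hH0⟩ := ne_zero_of_negLog_add_le hup
    replace hD0 := ((hPr.1 H).nonneg D).lt_of_ne' hD0
    replace hH0 := (hP.1.nonneg H).lt_of_ne' hH0
    rw [negLog_add_of_pos hD0 hH0, EReal.coe_le_coe_iff] at hup
    have h1 := hcond D H hD0
    have h2 := hSF P hP H 0 hH0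
    have h3 := hcode D H (hmK D H).1
    have h4 := hcode H 0 (hmK H 0).1
    have h5 := le_max_left (distK U P + c₁) c₄
    have h6 := le_max_right (distK U P + c₁) c₄
    simp only [prefixK] at hup
    exact ⟨(isRandom_iff ((hPr.1 H).nonneg D) (hmK D H).1).2 ⟨hD0, by linarith⟩,
      (isRandom_iff (hP.1.nonneg H) (hmK H 0).1).2 ⟨hH0, by linarith⟩⟩
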